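/- Let $k$ be a field. Let $\mathbf{Vect}$ be the category of $k$-vector spaces, $\mathbf{FDVect}$ the full subcategory of finite-dimensional ones, and $G\colon \mathbf{FDVect} \hookrightarrow \mathbf{Vect}$ the inclusion. The codensity monad $\mathbb{T} = (T,\eta,\mu)$ of $G$ is the right Kan extension of $G$ along itself, $T(X) = \int_{B\in\mathbf{FDVect}} [\mathbf{Vect}(X,B),B] = \lim_{(B,\, f\colon X\to B)} B$, with universal transformation $\kappa\colon TG\to G$ and with the monad structure determined by $\kappa\circ\eta G = 1_G$ and $\kappa\circ\mu G = \kappa\circ T\kappa$. A linearly compact vector space over $k$ is a $k$-vector space $V$ with a topology for which addition, negation and multiplication by each scalar are continuous, such that (1) the open affine subspaces form a basis for the topology; (2) every family of closed affine subspaces of $V$ with the finite intersection property has nonempty intersection; (3) the topology is Hausdorff. Let $\mathbf{LCVect}$ be the category of linearly compact vector spaces over $k$ and continuous linear maps. Then $\mathbb{T}$ is isomorphic, as a monad on $\mathbf{Vect}$, to the double dualization monad $X\mapsto X^{**}$, that is, the monad induced by the adjunction between the dualization functor $(\ )^*\colon\mathbf{Vect}^{\mathrm{op}}\to\mathbf{Vect}$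 and its left adjoint $(\ )^*\colon\mathbf{Vect}\to\mathbf{Vect}^{\mathrm{op}}$; and the category $\mathbf{Vect}^{\mathbb{T}}$ of $\mathbb{T}$-algebras is equivalent to $\mathbf{LCVect}$. -/

import Mathlib

open CategoryTheory CategoryTheory.Limits Opposite

universe v₁ v₂ u₁ u₂ u

noncomputable section

/-! ### Codensity monads -/

section Codensity

variable {B : Type u₁} [Category.{v₁} B] {A : Type u₂} [Category.{v₂} A]
variable (G : B ⥤ A) [G.HasPointwiseRightKanExtension G]

/-- The underlying endofunctor of the codensity monad of `G`: the (pointwise) right Kan extension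
of `G` along itself.  On objects it is `X ↦ lim_{(b, f : X ⟶ G b)} G b`, i.e. the end
`∫_b [A(X, G b), G b]`. -/
abbrev codensityFunctor : A ⥤ A := G.pointwiseRightKanExtension G

/-- The universal natural transformation `κ : T G ⟶ G` of the right Kan extension. -/
abbrev codensityCounit : G ⋙ codensityFunctor G ⟶ G := G.pointwiseRightKanExtensionCounit G

/-- The unit: the unique `η : 𝟭 ⟶ T` with `κ ∘ η G = 𝟙`. -/
def codensityUnit : 𝟭 A ⟶ codensityFunctor G :=
  (codensityFunctor G).liftOfIsRightKanExtension (codensityCounit G) (𝟭 A) (𝟙 G)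

/-- The multiplication: the unique `μ : T T ⟶ T` with `κ ∘ μ G = κ ∘ T κ`. -/
def codensityMul : codensityFunctor G ⋙ codensityFunctor G ⟶ codensityFunctor G :=
  (codensityFunctor G).liftOfIsRightKanExtension (codensityCounit G)
    (codensityFunctor G ⋙ codensityFunctor G)
    (Functor.whiskerRight (codensityCounit G) (codensityFunctor G) ≫ codensityCounit G)

theorem codensityUnit_fac (b : B) :
    (codensityUnit G).app (G.obj b) ≫ (codensityCounit G).app b = 𝟙 (G.obj b) :=
  (codensityFunctor G).liftOfIsRightKanExtension_fac_app (codensityCounit G) (𝟭 A) (𝟙 G) b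

theorem codensityMul_fac (b : B) :
    (codensityMul G).app (G.obj b) ≫ (codensityCounit G).app b =
      (codensityFunctor G).map ((codensityCounit G).app b) ≫ (codensityCounit G).app b :=
  (codensityFunctor G).liftOfIsRightKanExtension_fac_app (codensityCounit G)
    (codensityFunctor G ⋙ codensityFunctor G)
    (Functor.whiskerRight (codensityCounit G) (codensityFunctor G) ≫ codensityCounit G) b

/-- Maps into the right Kan extension are determined by their composites with `κ`. -/
theorem codensity_hom_ext {S : A ⥤ A} (α β : S ⟶ codensityFunctor G)
    (h : ∀ b, α.app (G.obj b) ≫ (codensityCounit G).app b =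
      β.app (G.obj b) ≫ (codensityCounit G).app b) : α = β :=
  (codensityFunctor G).hom_ext_of_isRightKanExtension (codensityCounit G) α β
    (by ext b; exact h b)

/-- The codensity monad of `G`. -/
def codensityMonad : Monad A where
  toFunctor := codensityFunctor G
  η := codensityUnit G
  μ := codensityMul G
  assoc := by
    have h : Functor.whiskerRight (codensityMul G) (codensityFunctor G) ≫ codensityMul G =
        (Functor.associator _ _ _).hom ≫
          Functor.whiskerLeft (codensityFunctor G) (codensityMul G) ≫ codensityMul G := by
      refine codensity_hom_ext G _ _ fun b => ?_
      simp only [NatTrans.comp_app, Functor.whiskerRight_app, Functor.whiskerLeft_app,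
        Functor.associator_hom_app, Category.assoc, Category.id_comp]
      rw [codensityMul_fac, ← Functor.map_comp_assoc, codensityMul_fac, Functor.map_comp_assoc]
      erw [← (codensityMul G).naturality_assoc, codensityMul_fac]
      rfl
    intro X
    have := congr_app h X
    simpa using this
  left_unit := by
    have h : Functor.whiskerLeft (codensityFunctor G) (codensityUnit G) ≫ codensityMul G =
        (Functor.rightUnitor _).hom := by
      refine codensity_hom_ext G _ _ fun b => ?_
      simp only [NatTrans.comp_app, Functor.whiskerLeft_app, Functor.rightUnitor_hom_app,
        Category.assoc]
      rw [codensityMul_fac]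
      have h₁ := (codensityUnit G).naturality ((codensityCounit G).app b)
      calc _ = (codensityCounit G).app b ≫ (codensityUnit G).app (G.obj b) ≫
            (codensityCounit G).app b := by
              rw [← Category.assoc, ← Category.assoc]; exact congrArg (· ≫ _) h₁.symm
        _ = (codensityCounit G).app b ≫ 𝟙 (G.obj b) := by rw [codensityUnit_fac]
        _ = _ := by rw [Category.comp_id]; exact (Category.id_comp _).symm
    intro X
    exact congr_app h X
  right_unit := by
    have h : Functor.whiskerRight (codensityUnit G) (codensityFunctor G) ≫ codensityMul G =
        (Functor.leftUnitor _).hom := by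
      refine codensity_hom_ext G _ _ fun b => ?_
      simp only [NatTrans.comp_app, Functor.whiskerRight_app, Functor.leftUnitor_hom_app,
        Category.assoc]
      rw [codensityMul_fac, ← Functor.map_comp_assoc, codensityUnit_fac]
      exact congrArg (· ≫ (codensityCounit G).app b)
        ((codensityFunctor G).map_id (G.obj b))
    intro X
    exact congr_app h X

end Codensity

/-! ### Vector spaces, finite-dimensional vector spaces, double dualization -/

section Vect

variable (k : Type u) [Field k]

/-- The inclusion of the full subcategory of finite-dimensional `k`-vector spaces into the category
of `k`-vector spaces. -/
abbrev fdVectInclusion : FGModuleCat.{u} k ⥤ ModuleCat.{u} k := (ModuleCat.isFG.{u} k).ι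

/-- The limits defining the codensity monad of `fdVectInclusion k` exist. -/
instance fdVectInclusion_hasPointwiseRightKanExtension :
    (fdVectInclusion k).HasPointwiseRightKanExtension (fdVectInclusion k) := fun X => by
  have : HasLimitsOfShape (StructuredArrow X (fdVectInclusion k)) (ModuleCat.{u} k) :=
    hasLimitsOfShape_of_essentiallySmall.{u} _ _
  change HasLimit _
  infer_instance

/-- The dualization functor `X ↦ X^*`, `f ↦ f^*`. -/
def dualFunctor : (ModuleCat.{u} k)ᵒᵖ ⥤ ModuleCat.{u} k where
  obj X := ModuleCat.of k (Module.Dual k X.unop)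
  map f := ModuleCat.ofHom f.unop.hom.dualMap

/-- Dualization is self-adjoint on the right; the unit and the counit are the evaluation maps
`X ⟶ X^{**}`. -/
def dualAdjunction : (dualFunctor k).rightOp ⊣ dualFunctor k :=
  Adjunction.mkOfUnitCounit
    { unit := { app := fun X => ModuleCat.ofHom (Module.Dual.eval k X) }
      counit := { app := fun X => (ModuleCat.ofHom (Module.Dual.eval k X.unop)).op }
      left_triangle := by
        ext X
        apply Quiver.Hom.unop_inj
        ext φ
        rfl
      right_triangle := by
        ext X φ
        rfl }

/-- The double dualization monad, with functor `X ↦ X^{**}`. -/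
def doubleDualMonad : Monad (ModuleCat.{u} k) := (dualAdjunction k).toMonad

end Vect

/-! ### Linearly compact vector spaces -/

/-- A topology on the `k`-vector space `V` makes it a linearly compact vector space.
No topology on `k` is involved (equivalently, `k` is discrete). -/
class IsLinearlyCompact (k : Type*) [Field k] (V : Type*) [AddCommGroup V] [Module k V]
    [TopologicalSpace V] : Prop where
  /-- addition and negation are continuous -/
  isTopologicalAddGroup : IsTopologicalAddGroup V
  /-- multiplication by each scalar is continuous -/
  continuousConstSMul : ContinuousConstSMul k V
  /-- the open affine subspaces form a basis for the topology -/
  isTopologicalBasis : TopologicalSpace.IsTopologicalBasis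
    {U : Set V | IsOpen U ∧ ∃ S : AffineSubspace k V, (S : Set V) = U}
  /-- every family of closed affine subspaces with the finite intersection property has nonempty
  intersection -/
  nonempty_sInter : ∀ F : Set (AffineSubspace k V), (∀ S ∈ F, IsClosed (S : Set V)) →
    (∀ F' : Finset (AffineSubspace k V), (F' : Set (AffineSubspace k V)) ⊆ F →
      (⋂ S ∈ F', (S : Set V)).Nonempty) →
    (⋂ S ∈ F, (S : Set V)).Nonempty
  /-- the topology is Hausdorff -/
  t2Space : T2Space V

/-- The type of linearly compact vector spaces over `k`. -/
structure LCVect (k : Type u) [Field k] where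
  /-- the underlying set -/
  carrier : Type u
  [addCommGroup : AddCommGroup carrier]
  [module : Module k carrier]
  [topologicalSpace : TopologicalSpace carrier]
  [isLinearlyCompact : IsLinearlyCompact k carrier]

attribute [instance] LCVect.addCommGroup LCVect.module LCVect.topologicalSpace
  LCVect.isLinearlyCompact

/-- The category of linearly compact vector spaces and continuous linear maps. -/
instance LCVect.category (k : Type u) [Field k] : Category.{u} (LCVect k) where
  Hom V W := V.carrier →L[k] W.carrier
  id V := ContinuousLinearMap.id k V.carrier
  comp f g := g.comp f

end

/-! A natural transformation β from SG to G extends uniquely to S → ( )**: an element s of S X sends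
a functional φ : X → k to β_k(S(φ)(s)). Linearity in φ comes from naturality of β along maps between
k × k and k. Hence ( )** is a right Kan extension of G along itself, and its unit and multiplication
satisfy the equations that characterize the codensity monad (`nonempty_codensityMonad_iso`).

For the algebras, dualization is exact and reflects isomorphisms, so Beck's theorem makes it monadic
and the algebras form Vectᵒᵖ. It remains to see that Vectᵒᵖ is LCVect. A dual with the pointwise
topology is linearly compact, because a consistent system of linear conditions on a functional is
solved by extending from a subspace. Its continuous functionals are exactly the evaluations, which
gives full faithfulness (`PointwiseDual.map_surjective`). Conversely, linear compactness makes V the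
dual of its continuous dual (`IsLinearlyCompact.evalEquiv`). -/

/-! ### Recognizing a codensity monad -/

section Recognition

variable {B : Type u₁} [Category.{v₁} B] {A : Type u₂} [Category.{v₂} A]
variable (G : B ⥤ A) [G.HasPointwiseRightKanExtension G] (M : Monad A)
  (δ : G ⋙ M.toFunctor ⟶ G)

/-- The comparison morphism from a monad acting on `G` to the codensity monad of `G`. -/
noncomputable def Monad.toCodensityMonad
    (hη : ∀ b, M.η.app (G.obj b) ≫ δ.app b = 𝟙 (G.obj b))
    (hμ : ∀ b, M.μ.app (G.obj b) ≫ δ.app b = M.map (δ.app b) ≫ δ.app b) :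
    M ⟶ codensityMonad G :=
  let φ : M.toFunctor ⟶ codensityFunctor G :=
    (codensityFunctor G).liftOfIsRightKanExtension (codensityCounit G) M.toFunctor δ
  have hφ : ∀ b, φ.app (G.obj b) ≫ (codensityCounit G).app b = δ.app b := fun b =>
    (codensityFunctor G).liftOfIsRightKanExtension_fac_app (codensityCounit G) M.toFunctor δ b
  { toNatTrans := φ
    app_η := by
      have h : M.η ≫ φ = codensityUnit G := by
        refine codensity_hom_ext G _ _ fun b => ?_
        rw [codensityUnit_fac, NatTrans.comp_app, Category.assoc, hφ]
        exact hη b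
      exact congr_app h
    app_μ := by
      have h : M.μ ≫ φ = (Functor.whiskerRight φ M.toFunctor ≫
          Functor.whiskerLeft (codensityFunctor G) φ) ≫ codensityMul G := by
        refine codensity_hom_ext G _ _ fun b => ?_
        simp only [NatTrans.comp_app, Functor.whiskerRight_app, Functor.whiskerLeft_app,
          Category.assoc]
        rw [hφ, hμ, codensityMul_fac, ← φ.naturality_assoc, hφ]
        erw [← Functor.map_comp_assoc]
        rw [hφ]
      exact congr_app h }

/-- A monad acting on `G` in such a way that it is a right Kan extension of `G` along itself is
the codensity monad of `G`. -/
theorem nonempty_codensityMonad_iso [M.toFunctor.IsRightKanExtension δ]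
    (hη : ∀ b, M.η.app (G.obj b) ≫ δ.app b = 𝟙 (G.obj b))
    (hμ : ∀ b, M.μ.app (G.obj b) ≫ δ.app b = M.map (δ.app b) ≫ δ.app b) :
    Nonempty (codensityMonad G ≅ M) := by
  let φ := Monad.toCodensityMonad G M δ hη hμ
  -- A map between two right Kan extensions that respects the counits is invertible.
  have h : IsIso ((monadToFunctor A).map φ) :=
    (Functor.isRightKanExtension_iff_isIso (F' := codensityFunctor G) φ.toNatTrans
      (codensityCounit G) δ ((codensityFunctor G).liftOfIsRightKanExtension_fac
        (codensityCounit G) M.toFunctor δ)).1 inferInstance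
  have : IsIso φ := isIso_of_reflects_iso φ (monadToFunctor A)
  exact ⟨(asIso φ).symm⟩

end Recognition

/-! ### Double dualization as a right Kan extension -/

section DoubleDual

variable (k : Type u) [Field k]

theorem Module.Dual.eq_of_forall_apply_eq {k V : Type*} [Field k] [AddCommGroup V] [Module k V]
    {x y : V} (h : ∀ φ : Module.Dual k V, φ x = φ y) : x = y :=
  Module.eval_apply_injective k (LinearMap.ext h)

/-- The action of double dualization on finite-dimensional vector spaces: the inverse of
evaluation. -/
noncomputable def doubleDualCounit :
    fdVectInclusion k ⋙ (doubleDualMonad k).toFunctor ⟶ fdVectInclusion k where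
  app B := ModuleCat.ofHom (Y := B.obj) (Module.evalEquiv k B.obj).symm.toLinearMap
  naturality B C f := by
    ext (x : Module.Dual k (Module.Dual k B.obj))
    refine Module.Dual.eq_of_forall_apply_eq (k := k) (V := C.obj) fun φ => ?_
    exact (Module.apply_evalEquiv_symm_apply k _ φ _).trans
      (Module.apply_evalEquiv_symm_apply k _ (φ ∘ₗ f.hom.hom) x).symm

theorem apply_doubleDualCounit (B : FGModuleCat.{u} k)
    (x : Module.Dual k (Module.Dual k B.obj)) (φ : Module.Dual k B.obj) :
    φ ((doubleDualCounit k).app B x) = x φ :=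
  Module.apply_evalEquiv_symm_apply k _ φ x

variable {k}

/-- The one-dimensional space, as a finite-dimensional space. -/
abbrev fdLine (k : Type u) [Field k] : FGModuleCat.{u} k := FGModuleCat.of k k

section Lift

variable {S : ModuleCat.{u} k ⥤ ModuleCat.{u} k} (β : fdVectInclusion k ⋙ S ⟶ fdVectInclusion k)

/-- The functional on the dual of `X` induced by an element of `S X`, on a single functional. -/
def liftEval {X : ModuleCat.{u} k} (s : S.obj X) (φ : Module.Dual k X) : k :=
  β.app (fdLine k) (S.map (ModuleCat.ofHom φ) s)

/-- Naturality of `β` at `φ : B ⟶ k`. Varying `φ` for a fixed `p` transfers the linear structure of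
the dual of `B` to `liftEval`. -/
theorem liftEval_comp {X : ModuleCat.{u} k} (s : S.obj X) (B : FGModuleCat.{u} k)
    (p : X ⟶ B.obj) (φ : Module.Dual k B.obj) :
    liftEval β s (φ ∘ₗ p.hom) = φ (β.app B (S.map p s)) := by
  have h := β.naturality (X := B) (Y := fdLine k) (ObjectProperty.homMk (ModuleCat.ofHom φ))
  have h' := congr($h (S.map p s))
  refine Eq.trans ?_ h'
  change β.app (fdLine k) (S.map (p ≫ ModuleCat.ofHom φ) s) = _
  rw [S.map_comp]
  rfl

theorem liftEval_add {X : ModuleCat.{u} k} (s : S.obj X) (φ ψ : Module.Dual k X) :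
    liftEval β s (φ + ψ) = liftEval β s φ + liftEval β s ψ := by
  -- `φ`, `ψ` and `φ + ψ` all factor through this one map, via the two projections and their sum.
  let p : X ⟶ (FGModuleCat.of k (k × k)).obj := ModuleCat.ofHom (φ.prod ψ)
  have h₁ := liftEval_comp β s _ p (LinearMap.fst k k k)
  have h₂ := liftEval_comp β s _ p (LinearMap.snd k k k)
  have h₃ := liftEval_comp β s _ p (LinearMap.fst k k k + LinearMap.snd k k k)
  exact h₃.trans (congrArg₂ (· + ·) h₁.symm h₂.symm)

theorem liftEval_smul {X : ModuleCat.{u} k} (s : S.obj X) (c : k) (φ : Module.Dual k X) :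
    liftEval β s (c • φ) = c * liftEval β s φ := by
  have h₁ := liftEval_comp β s (fdLine k) (ModuleCat.ofHom φ) LinearMap.id
  have h₂ := liftEval_comp β s (fdLine k) (ModuleCat.ofHom φ) (c • LinearMap.id)
  exact h₂.trans (congrArg (c * ·) h₁.symm)

/-- The transformation into double dualization induced by `β`. -/
def doubleDualLift : S ⟶ (doubleDualMonad k).toFunctor where
  app X := ModuleCat.ofHom (Y := Module.Dual k (Module.Dual k X))
    { toFun s :=
        { toFun φ := liftEval β s φ
          map_add' := liftEval_add β s
          map_smul' := liftEval_smul β s }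
      map_add' s t := by
        ext φ
        change β.app (fdLine k) (S.map _ (s + t)) =
          β.app (fdLine k) (S.map _ s) + β.app (fdLine k) (S.map _ t)
        rw [map_add, map_add]
      map_smul' c s := by
        ext φ
        change β.app (fdLine k) (S.map _ (c • s)) = _
        rw [map_smul]
        exact map_smul (β.app (fdLine k)).hom c _ }
  naturality X Y f := by
    ext s
    refine LinearMap.ext fun (φ : Module.Dual k Y) => ?_
    change liftEval β (S.map f s) φ = liftEval β s (φ ∘ₗ f.hom)
    change β.app (fdLine k) (S.map _ (S.map f s)) =
      β.app (fdLine k) (S.map (f ≫ ModuleCat.ofHom φ) s)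
    rw [S.map_comp]
    rfl

theorem doubleDualLift_fac :
    Functor.whiskerLeft (fdVectInclusion k) (doubleDualLift β) ≫ doubleDualCounit k = β := by
  ext B s
  refine Module.Dual.eq_of_forall_apply_eq (k := k) (V := B.obj) fun φ => ?_
  refine (apply_doubleDualCounit k B _ φ).trans ?_
  have h := liftEval_comp β s B (𝟙 _) φ
  rw [S.map_id] at h
  exact h

/-- Naturality of `γ` at `φ : X ⟶ k` reduces the value at `φ` to the component at the line, which
the counit determines. -/
theorem doubleDualLift_uniq (γ : S ⟶ (doubleDualMonad k).toFunctor)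
    (h : Functor.whiskerLeft (fdVectInclusion k) γ ≫ doubleDualCounit k = β) :
    γ = doubleDualLift β := by
  subst h
  ext X s
  refine LinearMap.ext fun (φ : Module.Dual k X) => ?_
  refine Eq.trans ?_ (apply_doubleDualCounit k (fdLine k) _ LinearMap.id).symm
  have h := congr($(γ.naturality (ModuleCat.ofHom φ)) s)
  exact (DFunLike.congr_fun (F := Module.Dual k (Module.Dual k k)) h LinearMap.id).symm

end Lift

variable (k)

instance isRightKanExtension_doubleDualCounit :
    (doubleDualMonad k).toFunctor.IsRightKanExtension (doubleDualCounit k) where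
  nonempty_isUniversal := ⟨IsTerminal.ofUniqueHom
    (fun E => CostructuredArrow.homMk (doubleDualLift E.hom) (doubleDualLift_fac E.hom))
    (fun E m => CostructuredArrow.hom_ext _ _
      (doubleDualLift_uniq E.hom m.left (CostructuredArrow.w m)))⟩

theorem nonempty_codensityMonad_iso_doubleDualMonad :
    Nonempty (codensityMonad (fdVectInclusion k) ≅ doubleDualMonad k) := by
  refine nonempty_codensityMonad_iso _ _ (doubleDualCounit k) (fun B => ?_) (fun B => ?_)
  · ext (x : B.obj)
    exact (Module.evalEquiv k B.obj).symm_apply_apply x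
  · ext (x : Module.Dual k (Module.Dual k (Module.Dual k (Module.Dual k B.obj))))
    refine Module.Dual.eq_of_forall_apply_eq (k := k) (V := B.obj) fun φ => ?_
    refine (apply_doubleDualCounit k B _ φ).trans ?_
    refine Eq.trans ?_ (apply_doubleDualCounit k B _ φ).symm
    -- Both arguments of `x` are the functional `ξ ↦ ξ φ` on the double dual of `B`.
    change x (Module.Dual.eval k (Module.Dual k B.obj) φ) = x _
    congr 1
    refine LinearMap.ext fun ξ => ?_
    exact (apply_doubleDualCounit k B ξ φ).symm

end DoubleDual

/-! ### Monadicity of dualization -/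

section Monadicity

variable (k : Type u) [Field k]

instance dualFunctor_reflectsIsomorphisms : (dualFunctor k).ReflectsIsomorphisms where
  reflects {X Y} f hf := by
    have h : Function.Bijective f.unop.hom.dualMap :=
      ConcreteCategory.bijective_of_isIso ((dualFunctor k).map f)
    have h' : Function.Bijective f.unop.hom := LinearMap.dualMap_bijective_iff.1 h
    have : IsIso f.unop := (ConcreteCategory.isIso_iff_bijective f.unop).2 h'
    exact (isIso_unop_iff f).1 this

variable {k}

theorem range_unop_π_of_isColimit {X Y : (ModuleCat.{u} k)ᵒᵖ} {f g : X ⟶ Y} {c : Cofork f g}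
    (hc : IsColimit c) :
    LinearMap.range c.π.unop.hom = LinearMap.ker (f.unop.hom - g.unop.hom) := by
  have hw (x) : f.unop (c.π.unop x) = g.unop (c.π.unop x) :=
    congr(($(c.condition).unop) x)
  ext y
  rw [LinearMap.mem_ker, LinearMap.sub_apply, sub_eq_zero]
  refine ⟨?_, fun hy => ?_⟩
  · rintro ⟨x, rfl⟩
    exact hw x
  -- Elements are maps out of `k`, so the universal property of the equalizer in vector spaces lifts
  -- `y`.
  · let m : ModuleCat.of k k ⟶ Y.unop := ModuleCat.ofHom (LinearMap.toSpanSingleton k _ y)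
    obtain ⟨l, hl⟩ := Cofork.IsColimit.desc' hc m.op (by
      apply Quiver.Hom.unop_inj
      ext
      change f.unop ((1 : k) • y) = g.unop ((1 : k) • y)
      rw [one_smul]
      exact hy)
    refine ⟨l.unop (1 : k), ?_⟩
    have h : c.π.unop (l.unop (1 : k)) = m (1 : k) := congr(($(hl).unop) (1 : k))
    exact h.trans (one_smul k y)

/-- The dual of an equalizer of vector spaces is a coequalizer. -/
theorem nonempty_isColimit_map_dualFunctor {X Y : (ModuleCat.{u} k)ᵒᵖ} {f g : X ⟶ Y}
    {c : Cofork f g} (hc : IsColimit c)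
    (w : (dualFunctor k).map f ≫ (dualFunctor k).map c.π =
      (dualFunctor k).map g ≫ (dualFunctor k).map c.π) :
    Nonempty (IsColimit (Cofork.ofπ ((dualFunctor k).map c.π) w)) := by
  let π : c.pt.unop →ₗ[k] Y.unop := c.π.unop.hom
  have hinj : Function.Injective π := by
    have : Epi c.π := Cofork.IsColimit.epi hc
    exact (ModuleCat.mono_iff_injective c.π.unop).1 inferInstance
  have hker : LinearMap.ker π.dualMap = LinearMap.range (f.unop.hom - g.unop.hom).dualMap := by
    rw [LinearMap.ker_dualMap_eq_dualAnnihilator_range,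
      LinearMap.range_dualMap_eq_dualAnnihilator_ker]
    exact congrArg _ (range_unop_π_of_isColimit hc)
  -- A linear section of `π.dualMap` yields the descended map `t.π ∘ s`; it is well behaved because
  -- `t.π` kills `ker π.dualMap`, by `hker`.
  obtain ⟨s, hs⟩ := π.dualMap.exists_rightInverse_of_surjective
    (LinearMap.range_eq_top.2 (LinearMap.dualMap_surjective_of_injective hinj))
  have hs' (ξ) : π.dualMap (s ξ) = ξ := LinearMap.congr_fun hs ξ
  refine ⟨Cofork.IsColimit.mk _ (fun t => ModuleCat.ofHom (t.π.hom ∘ₗ s)) (fun t => ?_)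
    fun t m hm => ?_⟩
  · ext (φ : Module.Dual k Y.unop)
    change t.π (s (π.dualMap φ)) = t.π φ
    have h : s (π.dualMap φ) - φ ∈ LinearMap.ker π.dualMap := by
      rw [LinearMap.mem_ker, map_sub, hs', sub_self]
    rw [hker] at h
    obtain ⟨ψ, hψ⟩ := h
    have hψ' : (s (π.dualMap φ) - φ : Module.Dual k Y.unop) =
        f.unop.hom.dualMap ψ - g.unop.hom.dualMap ψ := by
      rw [← hψ]
      ext x
      exact map_sub ψ _ _
    have ht : t.π (f.unop.hom.dualMap ψ) = t.π (g.unop.hom.dualMap ψ) := congr($(t.condition) ψ)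
    refine sub_eq_zero.1 ((map_sub t.π.hom _ _).symm.trans ?_)
    refine (congrArg t.π.hom hψ').trans ?_
    exact (map_sub t.π.hom _ _).trans (sub_eq_zero.2 ht)
  · ext ξ
    change m ξ = t.π (s ξ)
    rw [← hm]
    exact congrArg m (hs' ξ).symm

theorem preservesColimit_parallelPair_dualFunctor {X Y : (ModuleCat.{u} k)ᵒᵖ} (f g : X ⟶ Y) :
    PreservesColimit (parallelPair f g) (dualFunctor k) :=
  preservesColimit_of_preserves_colimit_cocone (coequalizerIsCoequalizer f g)
    ((isColimitMapCoconeCoforkEquiv _ _).symm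
      (nonempty_isColimit_map_dualFunctor (coequalizerIsCoequalizer f g) _).some)

variable (k)

/-- Beck's monadicity theorem; all coequalizers exist and are preserved, so the splitting hypothesis
plays no role. -/
theorem nonempty_doubleDualMonad_algebra_equivalence :
    Nonempty ((doubleDualMonad k).Algebra ≌ (ModuleCat.{u} k)ᵒᵖ) := by
  have : HasCoequalizers (ModuleCat.{u} k)ᵒᵖ := inferInstance
  have : Monad.HasCoequalizerOfIsSplitPair (dualFunctor k) := ⟨fun f g _ => inferInstance⟩
  have : Monad.PreservesColimitOfIsSplitPair (dualFunctor k) :=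
    ⟨fun f g _ => preservesColimit_parallelPair_dualFunctor f g⟩
  have := (Monad.monadicOfHasPreservesGSplitCoequalizersOfReflectsIsomorphisms
    (dualAdjunction k)).eqv
  exact ⟨(Monad.comparison (dualAdjunction k)).asEquivalence.symm⟩

end Monadicity

/-- A functional on `k ^ F` is a linear combination of the coordinates. -/
theorem LinearMap.exists_eq_sum_mul {k ι : Type*} [Field k] [Fintype ι] (ℓ : (ι → k) →ₗ[k] k) :
    ∃ c : ι → k, ∀ x, ℓ x = ∑ i, c i * x i := by
  classical
  refine ⟨fun i => ℓ (Pi.single i 1), fun x => ?_⟩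
  conv_lhs => rw [← LinearMap.sum_single_apply (fun _ : ι => k) x, map_sum]
  refine Finset.sum_congr rfl fun i _ => ?_
  rw [mul_comm, ← smul_eq_mul, ← map_smul, ← Pi.single_smul, smul_eq_mul, mul_one]

/-! ### The dual of a vector space, with the topology of pointwise convergence -/

/-- The dual of `V`, with the topology of pointwise convergence for the discrete topology
on `k`. -/
def PointwiseDual (k V : Type*) [Field k] [AddCommGroup V] [Module k V] := V →ₗ[k] k

namespace PointwiseDual

variable {k V W : Type*} [Field k] [AddCommGroup V] [Module k V] [AddCommGroup W] [Module k W]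

instance : AddCommGroup (PointwiseDual k V) := inferInstanceAs (AddCommGroup (V →ₗ[k] k))
instance : Module k (PointwiseDual k V) := inferInstanceAs (Module k (V →ₗ[k] k))
instance : FunLike (PointwiseDual k V) V k := inferInstanceAs (FunLike (V →ₗ[k] k) V k)
instance : LinearMapClass (PointwiseDual k V) k V k :=
  inferInstanceAs (LinearMapClass (V →ₗ[k] k) k V k)

@[ext] theorem ext {φ ψ : PointwiseDual k V} (h : ∀ v, φ v = ψ v) : φ = ψ := DFunLike.ext _ _ h

theorem add_apply (φ ψ : PointwiseDual k V) (v : V) : (φ + ψ) v = φ v + ψ v := rfl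
theorem sub_apply (φ ψ : PointwiseDual k V) (v : V) : (φ - ψ) v = φ v - ψ v := rfl
theorem smul_apply (c : k) (φ : PointwiseDual k V) (v : V) : (c • φ) v = c * φ v := rfl

instance : TopologicalSpace (PointwiseDual k V) where
  IsOpen U := ∀ φ ∈ U, ∃ F : Finset V, ∀ ψ : PointwiseDual k V, (∀ v ∈ F, ψ v = φ v) → ψ ∈ U
  isOpen_univ _ _ := ⟨∅, fun _ _ => trivial⟩
  isOpen_inter U U' hU hU' φ hφ := by
    classical
    obtain ⟨F, hF⟩ := hU φ hφ.1
    obtain ⟨F', hF'⟩ := hU' φ hφ.2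
    exact ⟨F ∪ F', fun ψ h => ⟨hF ψ fun v hv => h v (Finset.mem_union_left _ hv),
      hF' ψ fun v hv => h v (Finset.mem_union_right _ hv)⟩⟩
  isOpen_sUnion S hS := by
    rintro φ ⟨U, hU, hφ⟩
    obtain ⟨F, hF⟩ := hS U hU φ hφ
    exact ⟨F, fun ψ h => ⟨U, hU, hF ψ h⟩⟩

/-- The functionals that vanish on `F`. -/
def annihilator (F : Set V) : Submodule k (PointwiseDual k V) where
  carrier := {ψ | ∀ v ∈ F, ψ v = 0}
  add_mem' {φ ψ} hφ hψ v hv := by rw [add_apply, hφ v hv, hψ v hv, add_zero]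
  zero_mem' _ _ := rfl
  smul_mem' c φ hφ v hv := by rw [smul_apply, hφ v hv, mul_zero]

theorem mem_mk'_annihilator {F : Set V} {φ ψ : PointwiseDual k V} :
    ψ ∈ AffineSubspace.mk' φ (annihilator F) ↔ ∀ v ∈ F, ψ v = φ v := by
  rw [AffineSubspace.mem_mk']
  exact forall₂_congr fun v _ => sub_eq_zero

theorem isOpen_mk'_annihilator (F : Finset V) (φ : PointwiseDual k V) :
    IsOpen (AffineSubspace.mk' φ (annihilator (F : Set V)) : Set (PointwiseDual k V)) := by
  intro ψ hψ
  rw [SetLike.mem_coe, mem_mk'_annihilator] at hψ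
  refine ⟨F, fun χ hχ => ?_⟩
  rw [SetLike.mem_coe, mem_mk'_annihilator]
  exact fun v hv => (hχ v hv).trans (hψ v hv)

theorem self_mem_mk'_annihilator (F : Set V) (φ : PointwiseDual k V) :
    φ ∈ (AffineSubspace.mk' φ (annihilator F) : Set (PointwiseDual k V)) :=
  AffineSubspace.self_mem_mk' _ _

theorem isOpen_annihilator (F : Finset V) :
    IsOpen (annihilator (k := k) (F : Set V) : Set (PointwiseDual k V)) := fun _ hψ =>
  ⟨F, fun _ hχ v hv => (hχ v hv).trans (hψ v hv)⟩

instance : IsTopologicalAddGroup (PointwiseDual k V) where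
  continuous_add := by
    refine continuous_def.2 fun U hU => isOpen_prod_iff.2 fun φ ψ h => ?_
    obtain ⟨F, hF⟩ := hU _ h
    refine ⟨_, _, isOpen_mk'_annihilator F φ, isOpen_mk'_annihilator F ψ,
      self_mem_mk'_annihilator _ _, self_mem_mk'_annihilator _ _, ?_⟩
    rintro ⟨φ', ψ'⟩ ⟨hφ, hψ⟩
    refine hF _ fun v hv => ?_
    exact congrArg₂ (· + ·) (mem_mk'_annihilator.1 hφ v hv) (mem_mk'_annihilator.1 hψ v hv)
  continuous_neg := by
    refine continuous_def.2 fun U hU φ h => ?_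
    obtain ⟨F, hF⟩ := hU _ h
    exact ⟨F, fun ψ hψ => hF _ fun v hv => congrArg (- ·) (hψ v hv)⟩

instance : ContinuousConstSMul k (PointwiseDual k V) where
  continuous_const_smul c := by
    refine continuous_def.2 fun U hU φ h => ?_
    obtain ⟨F, hF⟩ := hU _ h
    exact ⟨F, fun ψ hψ => hF _ fun v hv => congrArg (c * ·) (hψ v hv)⟩

instance : T2Space (PointwiseDual k V) where
  t2 φ ψ h := by
    obtain ⟨v, hv⟩ : ∃ v, φ v ≠ ψ v := by
      by_contra! h'
      exact h (ext h')
    refine ⟨_, _, isOpen_mk'_annihilator {v} φ, isOpen_mk'_annihilator {v} ψ,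
      self_mem_mk'_annihilator _ _, self_mem_mk'_annihilator _ _, ?_⟩
    refine Set.disjoint_left.2 fun χ h₁ h₂ => hv ?_
    rw [← mem_mk'_annihilator.1 h₁ v (by simp), mem_mk'_annihilator.1 h₂ v (by simp)]

theorem isTopologicalBasis : TopologicalSpace.IsTopologicalBasis
    {U : Set (PointwiseDual k V) | IsOpen U ∧
      ∃ S : AffineSubspace k (PointwiseDual k V), (S : Set (PointwiseDual k V)) = U} := by
  refine TopologicalSpace.isTopologicalBasis_of_isOpen_of_nhds (fun U hU => hU.1)
    fun φ U hφ hU => ?_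
  obtain ⟨F, hF⟩ := hU φ hφ
  exact ⟨_, ⟨isOpen_mk'_annihilator F φ, _, rfl⟩, self_mem_mk'_annihilator _ _,
    fun ψ hψ => hF ψ (mem_mk'_annihilator.1 hψ)⟩

/-- The pairs `(v, c)` such that every functional in `S` takes the value `c` at `v`. -/
def commonGraph (S : Set (PointwiseDual k V)) : Submodule k (V × k) where
  carrier := {p | ∀ φ ∈ S, φ p.1 = p.2}
  add_mem' {p q} hp hq φ hφ := by
    rw [Prod.fst_add, Prod.snd_add, map_add, hp φ hφ, hq φ hφ]
  zero_mem' φ _ := map_zero φ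
  smul_mem' c p hp φ hφ := by
    rw [Prod.smul_fst, Prod.smul_snd, map_smul, hp φ hφ]

theorem commonGraph_anti {S T : Set (PointwiseDual k V)} (h : S ⊆ T) :
    commonGraph T ≤ commonGraph S := fun _ hp φ hφ => hp φ (h hφ)

/-- Separation: if `ψ ∉ S`, this is already visible on a finite set `F` of vectors. A functional on
`k ^ F` separating the restrictions is evaluation at some `w`, which is constant on `S` but takes
another value at `ψ`. -/
theorem mem_of_isClosed {S : AffineSubspace k (PointwiseDual k V)}
    (hS : IsClosed (S : Set (PointwiseDual k V))) (hne : (S : Set (PointwiseDual k V)).Nonempty)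
    {ψ : PointwiseDual k V}
    (h : ∀ p ∈ commonGraph (S : Set (PointwiseDual k V)), ψ p.1 = p.2) : ψ ∈ S := by
  by_contra hψ
  obtain ⟨F, hF⟩ := hS.isOpen_compl ψ hψ
  obtain ⟨φ₀, hφ₀⟩ := hne
  let r : PointwiseDual k V →ₗ[k] (F → k) :=
    { toFun φ v := φ v
      map_add' _ _ := rfl
      map_smul' _ _ := rfl }
  have hr : r (ψ - φ₀) ∉ S.direction.map r := by
    rintro ⟨χ, hχ, e⟩
    refine hF (χ + φ₀) (fun v hv => ?_) (S.vadd_mem_of_mem_direction hχ hφ₀)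
    have := congrFun e ⟨v, hv⟩
    rw [add_apply]
    exact eq_sub_iff_add_eq.1 this
  obtain ⟨ℓ, hℓ, hle⟩ := Submodule.exists_le_ker_of_notMem hr
  obtain ⟨c, hc⟩ := ℓ.exists_eq_sum_mul
  obtain ⟨w, hw⟩ : ∃ w : V, ∀ φ : PointwiseDual k V, ℓ (r φ) = φ w := by
    refine ⟨∑ v : F, c v • (v : V), fun φ => ?_⟩
    rw [hc, map_sum]
    exact Finset.sum_congr rfl fun v _ => (map_smul φ (c v) (v : V)).symm
  refine hℓ ?_
  rw [hw, sub_apply, sub_eq_zero]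
  refine h (w, φ₀ w) fun φ hφ => ?_
  have := hle (Submodule.mem_map_of_mem (S.vsub_mem_direction hφ hφ₀))
  rw [LinearMap.mem_ker, hw] at this
  exact sub_eq_zero.1 this

theorem exists_forall_mem_apply_eq (Γ : Submodule k (V × k)) (h : ((0 : V), (1 : k)) ∉ Γ) :
    ∃ ψ : PointwiseDual k V, ∀ p ∈ Γ, ψ p.1 = p.2 := by
  obtain ⟨ℓ, hℓ, hle⟩ := Submodule.exists_le_ker_of_notMem h
  -- Solve `ℓ (v, c) = ℓ (v, 0) + c * ℓ (0, 1) = 0` for `c`.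
  refine ⟨(-(ℓ (0, 1))⁻¹) • (ℓ ∘ₗ LinearMap.inl k V k : V →ₗ[k] k), fun p hp => ?_⟩
  have h₁ : ℓ p = 0 := hle hp
  have h₂ : p = LinearMap.inl k V k p.1 + p.2 • ((0 : V), (1 : k)) := by ext <;> simp
  rw [h₂, map_add, map_smul, smul_eq_mul] at h₁
  change (-(ℓ (0, 1))⁻¹) * ℓ (LinearMap.inl k V k p.1) = p.2
  rw [eq_neg_of_add_eq_zero_left h₁]
  field_simp

/-- For the intersection property, all equations valid on members of the family are pooled into `Γ`.
A contradiction `(0, 1) ∈ Γ` would involve finitely many members, whose common point would give `0 =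
1`. -/
instance : IsLinearlyCompact k (PointwiseDual k V) where
  isTopologicalAddGroup := inferInstance
  continuousConstSMul := inferInstance
  isTopologicalBasis := isTopologicalBasis
  t2Space := inferInstance
  nonempty_sInter 𝓕 hc hf := by
    classical
    let Γ : Submodule k (V × k) :=
      ⨆ S : 𝓕, commonGraph ((S : AffineSubspace k (PointwiseDual k V)) : Set (PointwiseDual k V))
    have hΓ : ((0 : V), (1 : k)) ∉ Γ := by
      intro h
      obtain ⟨s, hs⟩ := Submodule.mem_iSup_iff_exists_finset.1 h
      obtain ⟨φ, hφ⟩ := hf (s.map (Function.Embedding.subtype _)) (by simp)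
      have hle : (⨆ S ∈ s, commonGraph ((S : AffineSubspace k (PointwiseDual k V)) :
          Set (PointwiseDual k V))) ≤ commonGraph {φ} := by
        refine iSup₂_le fun S hS => commonGraph_anti (Set.singleton_subset_iff.2 ?_)
        exact Set.mem_iInter₂.1 hφ S (Finset.mem_map_of_mem _ hS)
      have := hle hs φ rfl
      exact zero_ne_one ((map_zero φ).symm.trans this)
    obtain ⟨ψ, hψ⟩ := exists_forall_mem_apply_eq Γ hΓ
    refine ⟨ψ, Set.mem_iInter₂.2 fun S hS => mem_of_isClosed (hc S hS) ?_ fun p hp => hψ p ?_⟩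
    · simpa using hf {S} (by simpa using hS)
    · exact Submodule.mem_iSup_of_mem (p := fun S : 𝓕 => commonGraph _) ⟨S, hS⟩ hp

/-- The transpose of a linear map, as a continuous linear map. -/
def map (f : V →ₗ[k] W) : PointwiseDual k W →L[k] PointwiseDual k V where
  toFun φ := (LinearMap.comp φ f : V →ₗ[k] k)
  map_add' _ _ := rfl
  map_smul' _ _ := rfl
  cont := by
    classical
    refine continuous_def.2 fun U hU φ h => ?_
    obtain ⟨F, hF⟩ := hU _ h
    exact ⟨F.image f, fun ψ hψ => hF _ fun v hv => hψ _ (Finset.mem_image_of_mem f hv)⟩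

/-- Every functional with open kernel is an evaluation. -/
theorem exists_eq_apply_of_isOpen_ker (ℓ : PointwiseDual k V →ₗ[k] k)
    (hℓ : IsOpen (LinearMap.ker ℓ : Set (PointwiseDual k V))) : ∃ v : V, ∀ φ, ℓ φ = φ v := by
  obtain ⟨F, hF⟩ := hℓ 0 (Submodule.zero_mem _)
  let L (v : F) : PointwiseDual k V →ₗ[k] k :=
    { toFun φ := φ v
      map_add' _ _ := rfl
      map_smul' _ _ := rfl }
  -- Openness at `0` bounds `ker ℓ` below by a finite intersection of kernels of evaluations.
  have h : ℓ ∈ Submodule.span k (Set.range L) := by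
    refine mem_span_of_iInf_ker_le_ker fun φ hφ => hF φ fun v hv => ?_
    exact (Submodule.mem_iInf _).1 hφ ⟨v, hv⟩
  obtain ⟨c, rfl⟩ := (Submodule.mem_span_range_iff_exists_fun k).1 h
  refine ⟨∑ v, c v • (v : V), fun φ => ?_⟩
  rw [map_sum, LinearMap.sum_apply]
  refine Finset.sum_congr rfl fun v _ => ?_
  rw [map_smul]
  rfl

/-- Every continuous linear map between duals is a transpose. -/
theorem map_surjective (g : PointwiseDual k W →L[k] PointwiseDual k V) :
    ∃ f : V →ₗ[k] W, map f = g := by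
  have h (v : V) : ∃ w : W, ∀ φ, g φ v = φ w := by
    let ℓ : PointwiseDual k W →ₗ[k] k :=
      { toFun φ := g φ v
        map_add' φ ψ := by rw [map_add, add_apply]
        map_smul' c φ := by rw [map_smul, smul_apply]; rfl }
    refine exists_eq_apply_of_isOpen_ker ℓ ?_
    have : (LinearMap.ker ℓ : Set (PointwiseDual k W)) =
        g ⁻¹' (annihilator (k := k) (({v} : Finset V) : Set V)) := by
      ext φ
      change g φ v = 0 ↔ ∀ w ∈ (({v} : Finset V) : Set V), g φ w = 0
      simp
    rw [this]
    exact (isOpen_annihilator {v}).preimage g.continuous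
  choose f hf using h
  refine ⟨{ toFun := f, map_add' := fun v w => ?_, map_smul' := fun c v => ?_ }, ?_⟩
  · refine Module.Dual.eq_of_forall_apply_eq (k := k) fun φ => ?_
    rw [map_add]
    refine (hf (v + w) φ).symm.trans ?_
    rw [map_add]
    exact congrArg₂ (· + ·) (hf v φ) (hf w φ)
  · refine Module.Dual.eq_of_forall_apply_eq (k := k) fun φ => ?_
    refine (hf (c • v) φ).symm.trans ?_
    rw [map_smul, map_smul]
    exact congrArg (c • ·) (hf v φ)
  · ext φ v
    exact (hf v φ).symm

end PointwiseDual

/-! ### Linearly compact spaces are duals -/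

namespace IsLinearlyCompact

variable {k V : Type*} [Field k] [AddCommGroup V] [Module k V] [TopologicalSpace V]
  [IsLinearlyCompact k V]

variable (k) in
theorem exists_isOpen_submodule_subset {N : Set V} (hN : IsOpen N) (h : (0 : V) ∈ N) :
    ∃ U : Submodule k V, IsOpen (U : Set V) ∧ (U : Set V) ⊆ N := by
  obtain ⟨_, ⟨hS, S, rfl⟩, h0, hSN⟩ :=
    (isTopologicalBasis (k := k) (V := V)).exists_subset_of_mem_open h hN
  have : (S.direction : Set V) = S := by
    ext x
    simpa using (S.vadd_mem_iff_mem_direction x h0).symm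
  exact ⟨S.direction, this ▸ hS, this ▸ hSN⟩

theorem isOpen_mono {U U' : Submodule k V} (h : U ≤ U') (hU : IsOpen (U : Set V)) :
    IsOpen (U' : Set V) :=
  have := isTopologicalAddGroup k (V := V)
  Submodule.isOpen_mono h hU

variable (k V) in
/-- The space of continuous functionals, for the discrete topology on `k`. -/
def continuousDual : Submodule k (Module.Dual k V) where
  carrier := {f | IsOpen (LinearMap.ker f : Set V)}
  add_mem' {f g} hf hg := by
    refine isOpen_mono (U := LinearMap.ker f ⊓ LinearMap.ker g) (fun x hx => ?_)
      (IsOpen.inter hf hg)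
    rw [LinearMap.mem_ker, LinearMap.add_apply, hx.1, hx.2, add_zero]
  zero_mem' := by simp
  smul_mem' c f hf := by
    refine isOpen_mono (U := LinearMap.ker f) (fun x hx => ?_) hf
    rw [LinearMap.mem_ker, LinearMap.smul_apply, hx, smul_zero]

theorem isOpen_setOf_apply_eq (f : continuousDual k V) (x : V) :
    IsOpen {y | f.1 y = f.1 x} := by
  have := isTopologicalAddGroup k (V := V)
  have h : {y | f.1 y = f.1 x} = (fun y => y - x) ⁻¹' (LinearMap.ker f.1 : Set V) := by
    ext y
    simp [sub_eq_zero]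
  rw [h]
  exact IsOpen.preimage (continuous_id.sub continuous_const) f.2

/-- An affine hyperplane (or `∅`, or the whole space). -/
def hyperplane (f : Module.Dual k V) (c : k) : AffineSubspace k V where
  carrier := {x | f x = c}
  smul_vsub_vadd_mem' a x y z hx hy hz := by
    change f (a • (x - y) + z) = c
    rw [map_add, map_smul, map_sub, hx, hy, hz, sub_self, smul_zero, zero_add]

theorem isClosed_hyperplane (f : continuousDual k V) (c : k) :
    IsClosed (hyperplane f.1 c : Set V) := by
  refine isOpen_compl_iff.1 (isOpen_iff_forall_mem_open.2 fun x hx => ?_)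
  exact ⟨_, fun y (hy : f.1 y = f.1 x) h => hx (hy.symm.trans h), isOpen_setOf_apply_eq f x, rfl⟩

/-- A system of linear equations all of whose finite subsystems are solvable is solvable. -/
theorem exists_forall_apply_eq {ι : Type*} (f : ι → continuousDual k V) (c : ι → k)
    (h : ∀ T : Finset ι, ∃ x, ∀ i ∈ T, (f i).1 x = c i) : ∃ x, ∀ i, (f i).1 x = c i := by
  classical
  obtain ⟨x, hx⟩ := nonempty_sInter (k := k) (V := V)
    ((fun i => hyperplane (f i).1 (c i)) '' Set.univ)
    (by
      rintro _ ⟨i, -, rfl⟩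
      exact isClosed_hyperplane _ _)
    (fun F' hF' => by
      obtain ⟨T, -, rfl⟩ := Finset.subset_set_image_iff.1 hF'
      obtain ⟨x, hx⟩ := h T
      refine ⟨x, Set.mem_iInter₂.2 fun S hS => ?_⟩
      obtain ⟨i, hi, rfl⟩ := Finset.mem_image.1 hS
      exact hx i hi)
  exact ⟨x, fun i => Set.mem_iInter₂.1 hx _ ⟨i, trivial, rfl⟩⟩

/-- An open subspace is cut out by finitely many continuous functionals. -/
theorem exists_finset_continuousDual {U : Submodule k V} (hU : IsOpen (U : Set V)) :
    ∃ F : Finset (continuousDual k V), ∀ x, (∀ f ∈ F, f.1 x = 0) → x ∈ U := by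
  classical
  let b := Module.Basis.ofVectorSpace k (V ⧸ U)
  let f (i) : continuousDual k V := ⟨b.coord i ∘ₗ U.mkQ, by
    refine isOpen_mono (U := U) (fun x hx => ?_) hU
    rw [LinearMap.mem_ker, LinearMap.comp_apply, U.mkQ_apply,
      (Submodule.Quotient.mk_eq_zero U).2 hx, map_zero]⟩
  -- Compactness forces `V ⧸ U` to be finite-dimensional: some vector has every coordinate equal to
  -- `1`, yet its support is finite.
  obtain ⟨x, hx⟩ := exists_forall_apply_eq f (fun _ => 1) fun T => by
    obtain ⟨x, hx⟩ := U.mkQ_surjective (∑ i ∈ T, b i)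
    refine ⟨x, fun i hi => ?_⟩
    change b.coord i (U.mkQ x) = 1
    rw [hx, map_sum, Finset.sum_eq_single_of_mem i hi]
    · simp
    · intro j _ hj
      simp [hj]
  refine ⟨(b.repr (U.mkQ x)).support.image f, fun y hy => ?_⟩
  rw [← Submodule.Quotient.mk_eq_zero, ← b.forall_coord_eq_zero_iff]
  refine fun i => hy (f i) (Finset.mem_image_of_mem f (Finsupp.mem_support_iff.2 ?_))
  have : b.repr (U.mkQ x) i = 1 := hx i
  rw [this]
  exact one_ne_zero

variable (k V) in
/-- Evaluation of continuous functionals. -/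
def eval : V →ₗ[k] PointwiseDual k (continuousDual k V) :=
  ((continuousDual k V).subtype.flip : V →ₗ[k] continuousDual k V →ₗ[k] k)

/-- The Hausdorff property gives an open subspace missing `x ≠ 0`; a functional vanishing on it but
not at `x` is continuous. -/
theorem eval_injective : Function.Injective (eval k V) := by
  have := t2Space k (V := V)
  rw [injective_iff_map_eq_zero]
  intro x hx
  by_contra h
  obtain ⟨U, hU, hUx⟩ := exists_isOpen_submodule_subset k
    (isOpen_compl_singleton (x := x)) (fun e => h (Eq.symm e))
  obtain ⟨f, hf, hle⟩ := U.exists_le_ker_of_notMem (v := x) fun h' => hUx h' rfl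
  exact hf (DFunLike.congr_fun hx ⟨f, isOpen_mono hle hU⟩)

/-- Compactness leaves finitely many equations `f x = ξ f`. They could only fail through a linear
relation among the `f`, which `ξ` respects. -/
theorem eval_surjective : Function.Surjective (eval k V) := by
  intro ξ
  obtain ⟨x, hx⟩ := exists_forall_apply_eq (id : continuousDual k V → _) ξ fun T => by
    let r : V →ₗ[k] (T → k) := LinearMap.pi fun f => f.1.1
    have h : (fun f : T => ξ f) ∈ LinearMap.range r := by
      by_contra h
      obtain ⟨ℓ, hℓ, hle⟩ := Submodule.exists_le_ker_of_notMem h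
      obtain ⟨c, hc⟩ := ℓ.exists_eq_sum_mul
      have h₀ : ∑ f : T, c f • (f : continuousDual k V) = 0 := by
        ext x
        have h₁ : ℓ (r x) = 0 := hle ⟨x, rfl⟩
        rw [hc] at h₁
        simpa [LinearMap.sum_apply, r] using h₁
      refine hℓ ?_
      rw [hc]
      have h₂ := congrArg ξ h₀
      rw [map_sum, map_zero] at h₂
      simpa using h₂
    obtain ⟨x, hx⟩ := h
    exact ⟨x, fun f hf => congrFun hx ⟨f, hf⟩⟩
  exact ⟨x, PointwiseDual.ext hx⟩

theorem continuous_eval : Continuous (eval k V) := by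
  refine continuous_def.2 fun U hU => isOpen_iff_forall_mem_open.2 fun x hx => ?_
  obtain ⟨F, hF⟩ := hU _ hx
  refine ⟨⋂ f ∈ F, {y | f.1 y = f.1 x}, fun y hy => hF _ fun f hf => Set.mem_iInter₂.1 hy f hf,
    isOpen_biInter_finset fun f _ => isOpen_setOf_apply_eq f x, ?_⟩
  exact Set.mem_iInter₂.2 fun f _ => rfl

theorem isOpenMap_eval : IsOpenMap (eval k V) := by
  have := isTopologicalAddGroup k (V := V)
  rintro N hN _ ⟨x, hx, rfl⟩
  obtain ⟨U, hU, hUN⟩ := exists_isOpen_submodule_subset k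
    (hN.preimage (continuous_add_const x)) (by simpa using hx)
  -- This `F` also serves as the finite set defining a pointwise neighbourhood of `eval k V x`
  -- inside the image.
  obtain ⟨F, hF⟩ := exists_finset_continuousDual hU
  refine ⟨F, fun ψ hψ => ?_⟩
  obtain ⟨y, rfl⟩ := eval_surjective ψ
  refine ⟨y, ?_, rfl⟩
  have h : y - x ∈ U := hF _ fun f hf => by
    rw [map_sub, sub_eq_zero]
    exact hψ f hf
  simpa using hUN h

variable (k V) in
/-- A linearly compact space is the dual of its space of continuous functionals. -/
noncomputable def evalEquiv : V ≃L[k] PointwiseDual k (continuousDual k V) :=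
  { LinearEquiv.ofBijective (eval k V) ⟨eval_injective, eval_surjective⟩ with
    continuous_toFun := continuous_eval
    continuous_invFun :=
      ((LinearEquiv.ofBijective (eval k V)
        ⟨eval_injective, eval_surjective⟩).toEquiv.toHomeomorphOfContinuousOpen
          continuous_eval isOpenMap_eval).continuous_symm }

end IsLinearlyCompact

/-! ### Dualization as an equivalence from Vectᵒᵖ to LCVect -/

section Duality

variable (k : Type u) [Field k]

variable {k} in
/-- A continuous linear equivalence is an isomorphism of linearly compact spaces. -/
def LCVect.isoMk {V W : LCVect k} (e : V.carrier ≃L[k] W.carrier) : V ≅ W where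
  hom := (e : V.carrier →L[k] W.carrier)
  inv := (e.symm : W.carrier →L[k] V.carrier)
  hom_inv_id := e.coe_symm_comp_coe
  inv_hom_id := e.coe_comp_coe_symm

/-- Dualization, as a functor to linearly compact spaces. -/
def dualLCVect : (ModuleCat.{u} k)ᵒᵖ ⥤ LCVect k where
  obj X := { carrier := PointwiseDual k X.unop }
  map f := PointwiseDual.map f.unop.hom

instance : (dualLCVect k).Full where
  map_surjective {X Y} g := by
    obtain ⟨f, hf⟩ := PointwiseDual.map_surjective (V := Y.unop) (W := X.unop) g
    exact ⟨(ModuleCat.ofHom f).op, hf⟩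

instance : (dualLCVect k).Faithful where
  map_injective {X Y} f g h := by
    apply Quiver.Hom.unop_inj
    ext y
    refine Module.Dual.eq_of_forall_apply_eq (k := k) fun φ => ?_
    have h' : PointwiseDual.map f.unop.hom = PointwiseDual.map g.unop.hom := h
    exact DFunLike.congr_fun (DFunLike.congr_fun h' φ) y

instance : (dualLCVect k).EssSurj where
  mem_essImage V := by
    let e := IsLinearlyCompact.evalEquiv k V.carrier
    exact ⟨op (ModuleCat.of k (IsLinearlyCompact.continuousDual k V.carrier)),
      ⟨LCVect.isoMk (V := (dualLCVect k).obj _) e.symm⟩⟩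

instance : (dualLCVect k).IsEquivalence where

end Duality

theorem mainTheorem7 (k : Type u) [Field k] :
    Nonempty (codensityMonad (fdVectInclusion k) ≅ doubleDualMonad k) ∧
      Nonempty ((codensityMonad (fdVectInclusion k)).Algebra ≌ LCVect k) := by
  obtain ⟨e⟩ := nonempty_codensityMonad_iso_doubleDualMonad k
  obtain ⟨E⟩ := nonempty_doubleDualMonad_algebra_equivalence k
  exact ⟨⟨e⟩, ⟨(Monad.algebraEquivOfIsoMonads e).trans
    (E.trans (dualLCVect k).asEquivalence)⟩⟩
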